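/- Let $G$ be a non-cyclic group of order $2^\lambda$. Write $\mathfrak{s}(G)$ for the set of all subgroups of $G$ and $C_n$ for the cyclic group of order $n$. For $\lambda \geq 4$ let $$M_{2^\lambda} = \langle a, b \mid a^{2^{\lambda-1}} = b^2 = 1,\ b^{-1}ab = a^{1+2^{\lambda-2}} \rangle,$$ and for $\lambda \geq 3$ let $$Q_{2^\lambda} = \langle x, y \mid x^{2^{\lambda-1}} = 1,\ y^2 = x^{2^{\lambda-2}},\ y^{-1}xy = x^{-1} \rangle$$ be the generalised quaternion group of order $2^\lambda$. 1. If $\lambda \geq 5$, then $|\mathfrak{s}(G)| \geq 3\lambda - 1$, with equality if and only if $G \cong C_{2^{\lambda-1}} \times C_2$ or $G \cong M_{2^\lambda}$. 2. If $\lambda = 3$, then $|\mathfrak{s}(G)| \geq 6$, with equality if and only if $G \cong Q_8$. 3. If $\lambda = 4$, then $|\mathfrak{s}(G)| \geq 11$, with equality if and only if $G \cong Q_{16}$, or $G \cong M_{16}$, or $G \cong C_8 \times C_2$. -/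

import Mathlib

/-- The relators, in the free group on two generators `a = of 0`, `b = of 1`, of the presentation
`⟨a, b ∣ a ^ p ^ (l - 1) = b ^ p = 1, a ^ b = a ^ (1 + p ^ (l - 2))⟩`, where `a ^ b = b⁻¹ * a * b`. -/
def modularRels (p l : ℕ) : Set (FreeGroup (Fin 2)) :=
  {FreeGroup.of 0 ^ p ^ (l - 1),
   FreeGroup.of 1 ^ p,
   (FreeGroup.of 1)⁻¹ * FreeGroup.of 0 * FreeGroup.of 1 *
     (FreeGroup.of 0 ^ (1 + p ^ (l - 2)))⁻¹}

/-- The modular group `M_{p^l}`, given by its presentation. -/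
abbrev ModularGroup (p l : ℕ) : Type := PresentedGroup (modularRels p l)

/-- The cyclic group `C_n` of order `n` (for `n ≠ 0`), written multiplicatively. -/
abbrev CyclicGrp (n : ℕ) : Type := Multiplicative (ZMod n)

open Subgroup

/-! A noncyclic 2-group `G` has at least three subgroups outside any index-two subgroup `M`: `G`
itself and two further subgroups of index two. Hence passing from `M` to `G` adds at least 3
subgroups (`card_subgroup_add_three_le`), and the bound `3λ - 1` follows by induction once it has a
place to start.

If `G` contains a Klein four-group, `M` can be chosen to contain it, down to order 4, where there
are 5 subgroups. Otherwise `G` has a unique involution. In orders 8 and 16 this forces the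
generalised quaternion relations, and a direct count gives 6 and 11 subgroups. As 11 is `3λ - 1` for
`λ = 4`, the induction starts at order 16. Above that, a noncyclic `M` always exists when there is
no Klein four-group.

In case of equality for `λ ≥ 5`, or for `λ = 4` with a Klein four-group, the last step adds exactly
3. Then any element of `M₂` or `M₃` outside `M` generates that subgroup, so `G` has two cyclic
subgroups `⟨g⟩ ≠ ⟨h⟩` of index two. In order at least 16 this yields an involution `b` outside `⟨g⟩`
commuting with `g²`, so `b` either centralises `g` or acts as in the modular group
(`exists_modular_generators`). Conversely, a subgroup of either group is determined by its trace on
`⟨a⟩` and one of three coset types, giving at most `3λ - 1` (`card_subgroup_le_of_modular`). -/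

/-! ### Subgroups of index two in finite 2-groups -/

theorem card_eq_of_index_eq_two {G : Type*} [Group G] {l : ℕ} (hcard : Nat.card G = 2 ^ (l + 1))
    {M : Subgroup G} (hM : M.index = 2) : Nat.card M = 2 ^ l := by
  have := M.card_mul_index
  rw [hM, hcard, pow_succ] at this
  omega

theorem index_eq_two_of_card {G : Type*} [Group G] {l : ℕ} (hcard : Nat.card G = 2 ^ (l + 1))
    {M : Subgroup G} (hM : Nat.card M = 2 ^ l) : M.index = 2 := by
  have := M.card_mul_index
  rw [hM, hcard, pow_succ] at this
  exact Nat.eq_of_mul_eq_mul_left (by positivity) this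

theorem eq_of_le_of_index_eq_two {G : Type*} [Group G] [Finite G] {M N : Subgroup G}
    (hM : M.index = 2) (hN : N.index = 2) (h : M ≤ N) : M = N := by
  apply Subgroup.eq_of_le_of_card_ge h
  have h1 := M.card_mul_index
  have h2 := N.card_mul_index
  rw [hM] at h1; rw [hN] at h2
  omega

/-- A proper subgroup of a finite 2-group lies in a subgroup of index two. -/
theorem exists_index_eq_two_ge {G : Type*} [Group G] {l : ℕ} (hcard : Nat.card G = 2 ^ l)
    {H : Subgroup G} (hH : H ≠ ⊤) : ∃ M : Subgroup G, M.index = 2 ∧ H ≤ M := by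
  have : Finite G := Nat.finite_of_card_ne_zero (by rw [hcard]; positivity)
  obtain ⟨k, hk, hkc⟩ := (Nat.dvd_prime_pow Nat.prime_two).1 (hcard ▸ H.card_subgroup_dvd_card)
  have hlt : k < l := by
    refine lt_of_le_of_ne hk fun h => hH ?_
    exact Subgroup.eq_top_of_card_eq _ (by rw [hkc, hcard, h])
  obtain ⟨m, rfl⟩ : ∃ m, l = m + 1 := ⟨l - 1, by omega⟩
  obtain ⟨K, hK, hle⟩ := Sylow.exists_subgroup_card_pow_prime_le 2 (n := k) (m := m)
    (by rw [hcard]; exact pow_dvd_pow _ (by omega)) H hkc (by omega)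
  exact ⟨K, index_eq_two_of_card hcard hK, hle⟩

theorem zpowers_ne_top {G : Type*} [Group G] (h : ¬ IsCyclic G) (g : G) : zpowers g ≠ ⊤ :=
  fun hg => h ⟨g, (Subgroup.eq_top_iff' _).1 hg⟩

/-- In a noncyclic 2-group every subgroup of index two is accompanied by two further ones, the
three of them covering the group. -/
theorem exists_three_index_eq_two {G : Type*} [Group G] {l : ℕ} (hcard : Nat.card G = 2 ^ l)
    (hcyc : ¬ IsCyclic G) {M : Subgroup G} (hM : M.index = 2) :
    ∃ M₂ M₃ : Subgroup G, M₂.index = 2 ∧ M₃.index = 2 ∧ ¬ M₂ ≤ M ∧ ¬ M₃ ≤ M ∧ M₂ ≠ M₃ := by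
  have : Finite G := Nat.finite_of_card_ne_zero (by rw [hcard]; positivity)
  obtain ⟨g, hg⟩ : ∃ g, g ∉ M := by
    by_contra! h
    rw [(Subgroup.eq_top_iff' _).2 h] at hM
    simp at hM
  obtain ⟨M₂, h₂, hle⟩ := exists_index_eq_two_ge hcard (zpowers_ne_top hcyc g)
  have hg₂ : g ∈ M₂ := hle (mem_zpowers g)
  obtain ⟨h, hhM, hh₂⟩ : ∃ h ∈ M, h ∉ M₂ := by
    by_contra! hc
    exact hg (eq_of_le_of_index_eq_two hM h₂ hc ▸ hg₂)
  -- The kernel of the product of the two sign characters with kernels `M` and `M₂`.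
  let M₃ : Subgroup G :=
    { carrier := {x | x ∈ M ↔ x ∈ M₂}
      mul_mem' := by
        intro a b ha hb
        simp only [Set.mem_ofPred_eq, mul_mem_iff_of_index_two hM, mul_mem_iff_of_index_two h₂]
          at ha hb ⊢
        tauto
      one_mem' := by simp [one_mem]
      inv_mem' := by
        intro a ha
        simpa using ha }
  have mem₃ : ∀ x, x ∈ M₃ ↔ (x ∈ M ↔ x ∈ M₂) := fun x => Iff.rfl
  refine ⟨M₂, M₃, h₂, ?_, fun hc => hg (hc hg₂), fun hc => ?_, fun hc => ?_⟩
  · refine index_eq_two_iff.2 ⟨g, fun b => ?_⟩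
    simp only [mem₃, mul_mem_iff_of_index_two hM, mul_mem_iff_of_index_two h₂, Xor]
    tauto
  · have : g * h ∈ M₃ := by
      simp only [mem₃, mul_mem_iff_of_index_two hM, mul_mem_iff_of_index_two h₂]
      tauto
    have := hc this
    rw [mul_mem_iff_of_index_two hM] at this
    tauto
  · have : g ∈ M₃ := hc ▸ hg₂
    rw [mem₃] at this
    tauto

theorem card_subgroup_coe {G : Type*} [Group G] (M : Subgroup G) :
    Nat.card (Subgroup M) = (Set.Iic M).ncard :=
  Nat.card_congr (Subgroup.MapSubtype.orderIso M).toEquiv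

/-- A noncyclic 2-group has at least three subgroups outside any subgroup of index two; if it has
only three, then two of them are cyclic of index two. -/
theorem card_subgroup_add_three_le {G : Type*} [Group G] {l : ℕ} (hcard : Nat.card G = 2 ^ l)
    (hcyc : ¬ IsCyclic G) {M : Subgroup G} (hM : M.index = 2) :
    Nat.card (Subgroup M) + 3 ≤ Nat.card (Subgroup G) ∧
    (Nat.card (Subgroup G) = Nat.card (Subgroup M) + 3 →
      ∃ g h : G, (zpowers g).index = 2 ∧ (zpowers h).index = 2 ∧ zpowers g ≠ zpowers h) := by
  have : Finite G := Nat.finite_of_card_ne_zero (by rw [hcard]; positivity)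
  obtain ⟨M₂, M₃, h₂, h₃, hn₂, hn₃, hne⟩ := exists_three_index_eq_two hcard hcyc hM
  have ne_top : ∀ {K : Subgroup G}, K.index = 2 → ⊤ ≠ K := by
    rintro K hK rfl
    simp at hK
  have hT : ({⊤, M₂, M₃} : Set (Subgroup G)).ncard = 3 :=
    Set.ncard_eq_three.2 ⟨_, _, _, ne_top h₂, ne_top h₃, hne, rfl⟩
  have hdisj : Disjoint (Set.Iic M) {⊤, M₂, M₃} := by
    rw [Set.disjoint_right]
    rintro K (rfl | rfl | rfl) hK
    · exact ne_top hM (top_le_iff.1 hK).symm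
    · exact hn₂ hK
    · exact hn₃ hK
  have hU := Set.ncard_union_eq hdisj
  rw [hT, ← card_subgroup_coe] at hU
  have hle := Set.ncard_le_ncard (Set.subset_univ (Set.Iic M ∪ {⊤, M₂, M₃}))
  rw [Set.ncard_univ] at hle
  refine ⟨by omega, fun heq => ?_⟩
  have huniv : Set.Iic M ∪ {⊤, M₂, M₃} = Set.univ := by
    apply Set.eq_of_subset_of_ncard_le (Set.subset_univ _)
    rw [Set.ncard_univ]; omega
  -- For `g` in `K` outside `M`, the subgroup `⟨g⟩` is neither below `M` nor the whole group, so it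
  -- is `M₂` or `M₃`. Having index two inside `K`, it equals `K`.
  have key : ∀ {K : Subgroup G}, K.index = 2 → ¬ K ≤ M → ∃ g, zpowers g = K := by
    intro K hK hKM
    obtain ⟨g, hgK, hgM⟩ := SetLike.not_le_iff_exists.1 hKM
    have hgle : zpowers g ≤ K := by simpa using hgK
    refine ⟨g, eq_of_le_of_index_eq_two ?_ hK hgle⟩
    have : zpowers g ∈ Set.Iic M ∪ {⊤, M₂, M₃} := huniv ▸ Set.mem_univ _
    rcases this with h | h | h | h
    · exact absurd (h (mem_zpowers g)) hgM
    · exact absurd h (zpowers_ne_top hcyc g)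
    · rwa [h]
    · rw [Set.mem_singleton_iff.1 h]; exact h₃
  obtain ⟨g, rfl⟩ := key h₂ hn₂
  obtain ⟨h, rfl⟩ := key h₃ hn₃
  exact ⟨g, h, h₂, h₃, hne⟩

/-! ### Commuting involutions -/

/-- Two commuting distinct involutions. -/
def HasCommutingInvolutions (G : Type*) [Group G] : Prop :=
  ∃ s t : G, s ≠ 1 ∧ t ≠ 1 ∧ s ≠ t ∧ s ^ 2 = 1 ∧ t ^ 2 = 1 ∧ Commute s t

/-- In a finite cyclic group `x² = 1` has at most two solutions, so `1`, `s`, `t` cannot be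
distinct. -/
theorem eq_of_sq_eq_one_of_mem_zpowers {G : Type*} [Group G] [Finite G] {a s t : G}
    (hs : s ∈ zpowers a) (ht : t ∈ zpowers a) (hs1 : s ≠ 1) (ht1 : t ≠ 1)
    (hs2 : s ^ 2 = 1) (ht2 : t ^ 2 = 1) : s = t := by
  by_contra hne
  classical
  have := Fintype.ofFinite (zpowers a)
  have h := IsCyclic.card_pow_eq_one_le (α := zpowers a) (n := 2) (by norm_num)
  have h3 : ({1, ⟨s, hs⟩, ⟨t, ht⟩} : Finset (zpowers a)).card = 3 :=
    Finset.card_eq_three.2 ⟨_, _, _, by simpa [Subtype.ext_iff] using hs1.symm,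
      by simpa [Subtype.ext_iff] using ht1.symm, by simpa using hne, rfl⟩
  have hsub : ({1, ⟨s, hs⟩, ⟨t, ht⟩} : Finset (zpowers a)) ⊆
      Finset.univ.filter fun x => x ^ 2 = 1 := by
    intro x hx
    simp only [Finset.mem_insert, Finset.mem_singleton] at hx
    rcases hx with rfl | rfl | rfl <;> simp [Subtype.ext_iff, hs2, ht2]
  have := Finset.card_le_card hsub
  omega

theorem HasCommutingInvolutions.not_isCyclic {G : Type*} [Group G] [Finite G]
    (h : HasCommutingInvolutions G) : ¬ IsCyclic G := by
  rintro ⟨a, ha⟩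
  obtain ⟨s, t, hs, ht, hst, hs2, ht2, -⟩ := h
  exact hst (eq_of_sq_eq_one_of_mem_zpowers (ha s) (ha t) hs ht hs2 ht2)

/-- A 2-group without two commuting involutions has a unique involution. -/
theorem exists_unique_involution {G : Type*} [Group G] {l : ℕ} (hcard : Nat.card G = 2 ^ (l + 1))
    (h : ¬ HasCommutingInvolutions G) :
    ∃ z : G, z ≠ 1 ∧ z ^ 2 = 1 ∧ ∀ x : G, x ^ 2 = 1 → x = 1 ∨ x = z := by
  have : Finite G := Nat.finite_of_card_ne_zero (by rw [hcard]; positivity)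
  have hp : IsPGroup 2 G := IsPGroup.of_card hcard
  have : Nontrivial G := by
    rw [← Finite.one_lt_card_iff_nontrivial, hcard]
    exact Nat.one_lt_two_pow (by omega)
  have : Fact (Nat.Prime 2) := ⟨Nat.prime_two⟩
  -- The involution `z` is taken in the centre, so that any other involution would commute with it.
  have hc := hp.center_nontrivial
  obtain ⟨k, hk⟩ := (IsPGroup.iff_card.1 (hp.to_subgroup (center G)))
  have hk0 : k ≠ 0 := by
    rintro rfl
    have := Finite.one_lt_card_iff_nontrivial.2 hc
    omega
  obtain ⟨z, hz⟩ := exists_prime_orderOf_dvd_card' (G := center G) 2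
    (by rw [hk]; exact dvd_pow_self _ hk0)
  have hz1 : (z : G) ≠ 1 := by
    intro h1
    have : z = 1 := Subtype.ext h1
    simp [this] at hz
  have hz2 : (z : G) ^ 2 = 1 := by
    have := pow_orderOf_eq_one z
    rw [hz] at this
    exact_mod_cast congrArg Subtype.val this
  refine ⟨z, hz1, hz2, fun x hx => ?_⟩
  by_contra! hx'
  exact h ⟨x, z, hx'.1, hz1, hx'.2, hx, hz2, mem_center_iff.1 z.2 x⟩

/-- The Klein four-group spanned by two commuting involutions lies in a subgroup of index two. -/
theorem HasCommutingInvolutions.exists_index_eq_two {G : Type*} [Group G] {l : ℕ}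
    (hcard : Nat.card G = 2 ^ (l + 3)) (h : HasCommutingInvolutions G) :
    ∃ M : Subgroup G, M.index = 2 ∧ HasCommutingInvolutions M := by
  obtain ⟨s, t, hs, ht, hst, hs2, ht2, hc⟩ := h
  have : Finite G := Nat.finite_of_card_ne_zero (by rw [hcard]; positivity)
  have hs' : s * s = 1 := by rw [← sq, hs2]
  have ht' : t * t = 1 := by rw [← sq, ht2]
  have hts : t * s = s * t := hc.symm
  let K : Subgroup G :=
    { carrier := {1, s, t, s * t}
      mul_mem' := by
        have e1 : ∀ x, s * (s * x) = x := fun x => by rw [← mul_assoc, hs', one_mul]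
        have e3 : ∀ x, t * (s * x) = s * (t * x) := fun x => by
          rw [← mul_assoc, hts, mul_assoc]
        rintro a b (rfl | rfl | rfl | rfl) (rfl | rfl | rfl | rfl) <;>
          simp [mul_assoc, hs', ht', hts, e1, e3]
      one_mem' := by simp
      inv_mem' := by
        have i1 : s⁻¹ = s := inv_eq_of_mul_eq_one_left hs'
        have i2 : t⁻¹ = t := inv_eq_of_mul_eq_one_left ht'
        rintro a (rfl | rfl | rfl | rfl) <;> simp [i1, i2, hts] }
  -- The bound of 4 on the order of `K` is enough, since `G` has order at least 8.
  have hK : K ≠ ⊤ := by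
    intro htop
    have h1 : Nat.card K = (({1, s, t, s * t} : Set G)).ncard := rfl
    have h2 : (({1, s, t, s * t} : Set G)).ncard ≤ 4 := by
      refine (Set.ncard_insert_le _ _).trans ?_
      have := Set.ncard_insert_le s {t, s * t}
      have := Set.ncard_insert_le t {s * t}
      have := Set.ncard_singleton (s * t)
      omega
    rw [htop, Subgroup.card_top, hcard, pow_add] at h1
    have := Nat.one_le_two_pow (n := l)
    omega
  obtain ⟨M, hM, hKM⟩ := exists_index_eq_two_ge hcard hK
  refine ⟨M, hM, ⟨s, hKM (by simp [K, ← SetLike.mem_coe])⟩,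
    ⟨t, hKM (by simp [K, ← SetLike.mem_coe])⟩, ?_⟩
  simp only [ne_eq, Subtype.ext_iff, commute_iff_eq]
  exact ⟨hs, ht, hst, hs2, ht2, hc⟩

/-- A 2-group with two commuting involutions has at least `3λ - 1` subgroups, where `2^λ` is its order;
in case of equality two of them are cyclic of index two. -/
theorem HasCommutingInvolutions.le_card_subgroup {l : ℕ} : ∀ {G : Type*} [Group G],
    Nat.card G = 2 ^ (l + 2) → HasCommutingInvolutions G →
    3 * l + 5 ≤ Nat.card (Subgroup G) ∧ (Nat.card (Subgroup G) = 3 * l + 5 →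
      ∃ g h : G, (zpowers g).index = 2 ∧ (zpowers h).index = 2 ∧ zpowers g ≠ zpowers h) := by
  induction l with
  | zero =>
    intro G _ hcard h
    have : Finite G := Nat.finite_of_card_ne_zero (by rw [hcard]; positivity)
    have hcyc := h.not_isCyclic
    -- In order 4, `M` has order 2 and exactly two subgroups, so the bound is 2 + 3 = 5.
    obtain ⟨M, hM, -⟩ := exists_index_eq_two_ge hcard (zpowers_ne_top hcyc 1)
    have hMc := card_eq_of_index_eq_two (l := 1) hcard hM
    have : Fact (Nat.card M).Prime := ⟨by rw [hMc]; norm_num⟩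
    have hnt : Nontrivial M := Finite.one_lt_card_iff_nontrivial.1 (by rw [hMc]; norm_num)
    have h2 : 1 < Nat.card (Subgroup M) := Finite.one_lt_card
    have := card_subgroup_add_three_le hcard hcyc hM
    have h2' : Nat.card (Subgroup M) ≤ 2 := by
      classical
      refine (Nat.card_le_card_of_injective (fun H : Subgroup M => decide (H = ⊥)) ?_).trans
        (by simp)
      intro H K hHK
      simp only [decide_eq_decide] at hHK
      rcases H.eq_bot_or_eq_top_of_prime_card with h1 | h1 <;>
        rcases K.eq_bot_or_eq_top_of_prime_card with h2 | h2 <;> simp_all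
    refine ⟨by omega, fun h5 => this.2 (by omega)⟩
  | succ l ih =>
    intro G _ hcard h
    have : Finite G := Nat.finite_of_card_ne_zero (by rw [hcard]; positivity)
    obtain ⟨M, hM, hM'⟩ := h.exists_index_eq_two (l := l) hcard
    have := (ih (card_eq_of_index_eq_two hcard hM) hM').1
    have h3 := card_subgroup_add_three_le hcard h.not_isCyclic hM
    exact ⟨by omega, fun h5 => h3.2 (by omega)⟩

/-! ### Groups with a unique involution -/

theorem orderOf_eq_of_index_eq_two {G : Type*} [Group G] {l : ℕ} (hcard : Nat.card G = 2 ^ (l + 1))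
    {a : G} (ha : (zpowers a).index = 2) : orderOf a = 2 ^ l := by
  rw [← Nat.card_zpowers, card_eq_of_index_eq_two hcard ha]

theorem zpow_eq_one_iff_of_orderOf {G : Type*} [Group G] {n : ℕ} {a : G} (ha : orderOf a = 2 ^ n)
    (m : ℤ) : a ^ m = 1 ↔ (2 : ℤ) ^ n ∣ m := by
  rw [← orderOf_dvd_iff_zpow_eq_one, ha]; norm_cast

/-- Turns the search for involutions in the coset `⟨a⟩b` into a linear congruence in `j`. -/
theorem zpow_mul_mul_sq {G : Type*} [Group G] {a b : G} {u k : ℤ} (hu : b * a * b⁻¹ = a ^ u)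
    (hk : b ^ 2 = a ^ k) (j : ℤ) : (a ^ j * b) ^ 2 = a ^ (j * (u + 1) + k) := by
  have h1 : b * a ^ j * b⁻¹ = a ^ (u * j) := by rw [← conj_zpow, hu, zpow_mul]
  calc (a ^ j * b) ^ 2 = a ^ j * (b * a ^ j * b⁻¹) * b ^ 2 := by simp only [sq]; group
    _ = _ := by rw [h1, hk, ← zpow_add, ← zpow_add]; congr 1; ring

theorem conj_mem_zpowers_of_index_eq_two {G : Type*} [Group G] {a : G}
    (ha : (zpowers a).index = 2) (b : G) : ∃ u : ℤ, b * a * b⁻¹ = a ^ u := by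
  obtain ⟨u, hu⟩ := (normal_of_index_eq_two ha).conj_mem a (mem_zpowers a) b
  exact ⟨u, hu.symm⟩

/-- The arithmetic behind the uniqueness of the generalised quaternion action. -/
theorem dvd_of_forall_not_dvd {n : ℕ} {u k : ℤ} (hu : (2 : ℤ) ^ (n + 2) ∣ u ^ 2 - 1)
    (hk : (2 : ℤ) ^ (n + 2) ∣ k * (u - 1)) (hk2 : (2 : ℤ) ∣ k)
    (hj : ∀ j : ℤ, ¬ (2 : ℤ) ^ (n + 2) ∣ j * (u + 1) + k) :
    (2 : ℤ) ^ (n + 2) ∣ u + 1 ∧ (2 : ℤ) ^ (n + 2) ∣ k - 2 ^ (n + 1) := by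
  have hodd : ∀ q : ℤ, IsCoprime ((2 : ℤ) ^ (n + 1)) (2 * q + 1) := fun q =>
    IsCoprime.pow_left ⟨-q, 1, by ring⟩
  have hpow : (2 : ℤ) ^ (n + 2) = 2 * 2 ^ (n + 1) := by ring
  have h2u : ¬ (2 : ℤ) ∣ u := by
    intro h
    have h1 : (2 : ℤ) ∣ u ^ 2 - 1 := (dvd_pow_self 2 (by omega)).trans hu
    have h2 : (2 : ℤ) ∣ u ^ 2 := dvd_pow h (by norm_num)
    omega
  rcases (by omega : u % 4 = 1 ∨ u % 4 = 3) with h4 | h4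
  -- Here `u + 1` is twice an odd number and `k` is even, so `j * (u + 1) + k ≡ 0` is solvable.
  · exfalso
    obtain ⟨q, rfl⟩ : ∃ q, u = 4 * q + 1 := ⟨u / 4, by omega⟩
    obtain ⟨k', rfl⟩ := hk2
    obtain ⟨x, y, hxy⟩ := hodd q
    refine hj (-k' * y) ?_
    rw [hpow]
    have : -k' * y * (4 * q + 1 + 1) + 2 * k' = 2 * (2 ^ (n + 1) * (k' * x)) := by
      linear_combination (-2 * k') * hxy
    rw [this]
    exact mul_dvd_mul_left _ (dvd_mul_right _ _)
  -- Now `u - 1` is twice an odd number; cancelling it shows that `2 ^ (n + 1)` divides both `k` and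
  -- `u + 1`.
  · obtain ⟨q, rfl⟩ : ∃ q, u = 4 * q + 3 := ⟨u / 4, by omega⟩
    have hk' : (2 : ℤ) ^ (n + 1) ∣ k := by
      refine (hodd q).dvd_of_dvd_mul_right ?_
      apply Int.dvd_of_mul_dvd_mul_left (two_ne_zero)
      rw [← hpow]
      convert hk using 1
      ring
    have hu' : (2 : ℤ) ^ (n + 1) ∣ 4 * q + 3 + 1 := by
      refine (hodd q).dvd_of_dvd_mul_right ?_
      apply Int.dvd_of_mul_dvd_mul_left (two_ne_zero)
      rw [← hpow]
      convert hu using 1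
      ring
    obtain ⟨k', rfl⟩ := hk'
    obtain ⟨w, hw⟩ := hu'
    rw [hw] at hj ⊢
    -- With `k = 2 ^ (n + 1) * k'` and `u + 1 = 2 ^ (n + 1) * w`, the case `j = 0` makes `k'` odd,
    -- and then `j = 1` makes `w` even.
    have h0 := hj 0
    have h1 := hj 1
    have hk'odd : ¬ (2 : ℤ) ∣ k' := by
      rintro ⟨c, rfl⟩
      exact h0 ⟨c, by rw [hpow]; ring⟩
    have hweven : (2 : ℤ) ∣ w := by
      by_contra hc
      obtain ⟨c, hc⟩ : (2 : ℤ) ∣ w + k' := by omega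
      exact h1 ⟨c, by rw [hpow]; linear_combination 2 ^ (n + 1) * hc⟩
    constructor
    · obtain ⟨c, rfl⟩ := hweven
      exact ⟨c, by rw [hpow]; ring⟩
    · obtain ⟨c, hc⟩ : (2 : ℤ) ∣ k' - 1 := by omega
      exact ⟨c, by rw [hpow]; linear_combination 2 ^ (n + 1) * hc⟩

theorem eq_top_of_index_eq_two_of_lt {G : Type*} [Group G] {M H : Subgroup G} (hM : M.index = 2)
    (hle : M ≤ H) {b : G} (hb : b ∈ H) (hbM : b ∉ M) : H = ⊤ := by
  refine (Subgroup.eq_top_iff' _).2 fun x => ?_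
  by_cases hx : x ∈ M
  · exact hle hx
  · have : x * b ∈ M := by rw [mul_mem_iff_of_index_two hM]; tauto
    simpa using H.mul_mem (hle this) (H.inv_mem hb)

/-- In a noncyclic 2-group with a unique involution and a cyclic subgroup `⟨a⟩` of index two, each
element outside `⟨a⟩` inverts `a` and squares to the involution. -/
theorem conj_eq_inv_of_unique_involution {G : Type*} [Group G] {n : ℕ}
    (hcard : Nat.card G = 2 ^ (n + 3)) (hcyc : ¬ IsCyclic G) {z : G}
    (hz : ∀ x : G, x ^ 2 = 1 → x = 1 ∨ x = z) {a b : G} (ha : (zpowers a).index = 2)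
    (hb : b ∉ zpowers a) : b * a * b⁻¹ = a⁻¹ ∧ b ^ 2 = a ^ 2 ^ (n + 1) := by
  have hord := orderOf_eq_of_index_eq_two (l := n + 2) hcard ha
  have hone := zpow_eq_one_iff_of_orderOf hord
  have hzmem : z ∈ zpowers a := by
    have h1 : a ^ (2 ^ (n + 1)) ≠ 1 := by
      apply pow_ne_one_of_lt_orderOf (by positivity)
      rw [hord]; exact Nat.pow_lt_pow_right (by norm_num) (by omega)
    have h2 : (a ^ (2 ^ (n + 1))) ^ 2 = 1 := by
      rw [← pow_mul, ← pow_succ, ← hord, pow_orderOf_eq_one]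
    rcases hz _ h2 with h | h
    · exact absurd h h1
    · exact h ▸ npow_mem_zpowers a _
  obtain ⟨u, hu⟩ := conj_mem_zpowers_of_index_eq_two ha b
  obtain ⟨k, hk⟩ := sq_mem_of_index_two ha b
  replace hk : b ^ 2 = a ^ k := hk.symm
  have conj : ∀ j : ℤ, b * a ^ j * b⁻¹ = a ^ (u * j) := fun j => by
    rw [← conj_zpow, hu, zpow_mul]
  -- Every solution of `x² = 1` lies in `⟨a⟩`, so no element of the other coset squares to 1.
  have hj : ∀ j : ℤ, ¬ (2 : ℤ) ^ (n + 2) ∣ j * (u + 1) + k := by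
    intro j hj
    rw [← hone, ← zpow_mul_mul_sq hu hk] at hj
    have hmem : a ^ j * b ∈ zpowers a := by
      rcases hz _ hj with h | h <;> rw [h]
      · exact one_mem _
      · exact hzmem
    exact hb ((mul_mem_cancel_left (zpow_mem_zpowers a j)).1 hmem)
  -- Conjugation by `b²`, a power of `a`, fixes `a`; below, `b` commutes with `b² = a ^ k`, which
  -- gives `u k ≡ k`.
  have hu1 : (2 : ℤ) ^ (n + 2) ∣ u ^ 2 - 1 := by
    rw [← hone, zpow_sub, zpow_one, mul_inv_eq_one, sq, ← conj u, ← hu]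
    calc b * (b * a * b⁻¹) * b⁻¹ = b ^ 2 * a * (b ^ 2)⁻¹ := by simp only [sq]; group
      _ = a := by rw [hk]; group
  have hk1 : (2 : ℤ) ^ (n + 2) ∣ k * (u - 1) := by
    rw [← hone, mul_sub, zpow_sub, mul_one, mul_inv_eq_one, mul_comm, ← conj, ← hk]
    simp only [sq]; group
  -- If `k` were odd, `b²` would generate `⟨a⟩`, and `⟨b⟩` would be all of `G`.
  have hk2 : (2 : ℤ) ∣ k := by
    by_contra hodd
    obtain ⟨x, y, hxy⟩ : IsCoprime k ((2 : ℤ) ^ (n + 2)) := by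
      apply IsCoprime.pow_right
      exact ⟨1, -(k / 2), by omega⟩
    have hab : a ∈ zpowers b := by
      refine ⟨2 * x, ?_⟩
      change b ^ (2 * x) = a
      have h2 : b ^ (2 : ℤ) = a ^ k := by exact_mod_cast hk
      rw [zpow_mul, h2, ← zpow_mul, ← mul_inv_eq_one, ← zpow_sub_one, hone]
      exact ⟨-y, by linear_combination hxy⟩
    refine zpowers_ne_top hcyc b
      (eq_top_of_index_eq_two_of_lt ha ?_ (mem_zpowers b) hb)
    rwa [zpowers_le]
  obtain ⟨h1, h2⟩ := dvd_of_forall_not_dvd hu1 hk1 hk2 hj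
  constructor
  · rw [hu, ← mul_eq_one_iff_eq_inv, ← zpow_add_one, hone]; exact h1
  · rw [hk, ← zpow_natCast, ← mul_inv_eq_one, ← zpow_sub, hone]; push_cast; exact h2

/-- A 2-group of exponent four with a unique involution has order at most eight. -/
theorem card_le_eight_of_unique_involution {G : Type*} [Group G] [Finite G] {z : G} (hz1 : z ≠ 1)
    (hz2 : z ^ 2 = 1) (hz : ∀ x : G, x ^ 2 = 1 → x = 1 ∨ x = z) (h4 : ∀ x : G, x ^ 4 = 1) :
    Nat.card G ≤ 8 := by
  have hsq : ∀ x : G, x ^ 2 = 1 ∨ x ^ 2 = z := fun x => hz _ (by rw [← pow_mul]; exact h4 x)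
  have hzc : ∀ x : G, x * z = z * x := by
    intro x
    rcases hz (x * z * x⁻¹) (by rw [conj_pow, hz2]; group) with h | h
    · simp [hz1] at h
    · rwa [mul_inv_eq_iff_eq_mul] at h
  by_cases hex : ∃ a : G, a ^ 2 = z
  swap
  · push Not at hex
    have hsub : (Set.univ : Set G) ⊆ {1, z} := by
      intro x _
      simpa using hz x ((hsq x).resolve_right (hex x))
    have := Set.ncard_le_ncard hsub
    have h2 := Set.ncard_insert_le (1 : G) {z}
    rw [Set.ncard_univ] at this
    rw [Set.ncard_singleton] at h2
    omega
  obtain ⟨a, ha⟩ := hex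
  have ha4 : orderOf a ≤ 4 := orderOf_le_of_pow_eq_one (by norm_num) (h4 a)
  -- The centraliser of `a` is `⟨a⟩`: if `x` commutes with `a` and `x² = z = a²`, then `x a⁻¹`
  -- squares to 1.
  have hcent : ∀ x : G, x * a = a * x → x ∈ zpowers a := by
    intro x hx
    have hzmem : z ∈ zpowers a := ha ▸ npow_mem_zpowers a 2
    rcases hsq x with h | h
    · rcases hz x h with h | h <;> rw [h]
      · exact one_mem _
      · exact hzmem
    · have hc : Commute x a⁻¹ := (Commute.inv_right hx)
      have : (x * a⁻¹) ^ 2 = 1 := by rw [hc.mul_pow, h, inv_pow, ha, mul_inv_cancel]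
      have hmem : x * a⁻¹ ∈ zpowers a := by
        rcases hz _ this with h | h <;> rw [h]
        · exact one_mem _
        · exact hzmem
      simpa using mul_mem hmem (mem_zpowers a)
  have hconj : ∀ g : G, g * a * g⁻¹ = a ∨ g * a * g⁻¹ = a⁻¹ := by
    intro g
    have haz : z * a⁻¹ = a := by rw [← ha]; group
    -- Both squares are `1` or the central element `z`, and `z a⁻¹ = a`; so the conjugate is `a` or
    -- `a⁻¹`.
    have key : g * a * g⁻¹ = (g * a) ^ 2 * a⁻¹ * (g ^ 2)⁻¹ := by simp only [sq]; group
    have hzi : z⁻¹ = z := inv_eq_of_mul_eq_one_left (by rw [← sq, hz2])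
    have hzz : z * z = 1 := by rw [← sq, hz2]
    rcases hsq (g * a) with h1 | h1 <;> rcases hsq g with h2 | h2 <;>
      rw [key, h1, h2]
    · right; simp
    · left; rw [hzi, one_mul, hzc, haz]
    · left; simp [haz]
    · right; rw [hzi, mul_assoc, hzc, ← mul_assoc, hzz, one_mul]
  have hA : (zpowers a : Set G).ncard ≤ 4 := by
    change Nat.card (zpowers a) ≤ 4
    rwa [Nat.card_zpowers]
  -- As `a` has at most two conjugates, its centraliser `⟨a⟩`, of order at most 4, has index at most
  -- 2.
  by_cases hex : ∃ c : G, c * a * c⁻¹ = a⁻¹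
  · obtain ⟨c, hc⟩ := hex
    have hsub : (Set.univ : Set G) ⊆ (zpowers a : Set G) ∪ (fun x => c * x) '' (zpowers a) := by
      intro g _
      rcases hconj g with h | h
      · left; exact hcent g (by rwa [mul_inv_eq_iff_eq_mul] at h)
      · right
        refine ⟨c⁻¹ * g, hcent _ ?_, by simp⟩
        have h1 : g * a = a⁻¹ * g := by rwa [mul_inv_eq_iff_eq_mul] at h
        have h2 : c⁻¹ * a⁻¹ = a * c⁻¹ := by rw [← hc]; group
        rw [mul_assoc, h1, ← mul_assoc, h2, mul_assoc]
    have h1 := Set.ncard_le_ncard hsub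
    have h2 := Set.ncard_union_le (zpowers a : Set G) ((fun x => c * x) '' (zpowers a))
    have h3 := Set.ncard_image_le (f := fun x => c * x) (Set.toFinite (zpowers a : Set G))
    rw [Set.ncard_univ] at h1
    omega
  · have hsub : (Set.univ : Set G) ⊆ (zpowers a : Set G) := by
      intro g _
      push Not at hex
      exact hcent g (by
        have := (hconj g).resolve_right (hex g)
        rwa [mul_inv_eq_iff_eq_mul] at this)
    have h1 := Set.ncard_le_ncard hsub
    rw [Set.ncard_univ] at h1
    omega

/-- An element of a noncyclic group of order `2 ^ (n + 2)` that is not killed by `2 ^ n`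
spans a subgroup of index two. -/
theorem index_zpowers_eq_two {G : Type*} [Group G] {n : ℕ} (hcard : Nat.card G = 2 ^ (n + 2))
    (hcyc : ¬ IsCyclic G) {a : G} (ha : a ^ 2 ^ n ≠ 1) : (zpowers a).index = 2 := by
  have : Finite G := Nat.finite_of_card_ne_zero (by rw [hcard]; positivity)
  apply index_eq_two_of_card (l := n + 1) hcard
  rw [Nat.card_zpowers]
  obtain ⟨k, hk, hord⟩ := (Nat.dvd_prime_pow Nat.prime_two).1 (hcard ▸ orderOf_dvd_natCard a)
  have h1 : k ≠ n + 2 := by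
    rintro rfl
    exact hcyc (isCyclic_of_orderOf_eq_card a (by rw [hord, hcard]))
  have h2 : ¬ k ≤ n := fun h => ha (orderOf_dvd_iff_pow_eq_one.1 (hord ▸ pow_dvd_pow 2 h))
  rw [hord]; congr 1; omega

/-- A noncyclic group of order 8 or 16 with a unique involution is generated by `a` and `b`
satisfying the relations of the generalised quaternion group. -/
theorem exists_quaternion_generators {G : Type*} [Group G] {n : ℕ} (hn : n ≤ 1)
    (hcard : Nat.card G = 2 ^ (n + 3)) (hcyc : ¬ IsCyclic G) {z : G} (hz1 : z ≠ 1)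
    (hz2 : z ^ 2 = 1) (hz : ∀ x : G, x ^ 2 = 1 → x = 1 ∨ x = z) :
    ∃ a b : G, (zpowers a).index = 2 ∧ b ∉ zpowers a ∧ b * a * b⁻¹ = a⁻¹ ∧
      b ^ 2 = a ^ 2 ^ (n + 1) := by
  have : Finite G := Nat.finite_of_card_ne_zero (by rw [hcard]; positivity)
  -- Otherwise the exponent divides 2 (for `n = 0`) or 4 (for `n = 1`), which bounds the order by 2
  -- or 8.
  obtain ⟨a, ha⟩ : ∃ a : G, a ^ 2 ^ (n + 1) ≠ 1 := by
    by_contra! h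
    interval_cases n
    · have hsub : (Set.univ : Set G) ⊆ {1, z} := fun x _ => by simpa using hz x (by simpa using h x)
      have := Set.ncard_le_ncard hsub
      have h2 := Set.ncard_insert_le (1 : G) {z}
      rw [Set.ncard_univ] at this
      rw [Set.ncard_singleton] at h2
      omega
    · have := card_le_eight_of_unique_involution hz1 hz2 hz (by simpa using h)
      omega
  have ha := index_zpowers_eq_two (n := n + 1) hcard hcyc ha
  obtain ⟨b, hb⟩ : ∃ b, b ∉ zpowers a := by
    by_contra! h
    exact zpowers_ne_top hcyc a ((Subgroup.eq_top_iff' _).2 h)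
  exact ⟨a, b, ha, hb, conj_eq_inv_of_unique_involution hcard hcyc hz ha hb⟩

/-! ### Two cyclic subgroups of index two -/

theorem notMem_of_zpowers_ne {G : Type*} [Group G] [Finite G] {g h : G}
    (hg : (zpowers g).index = 2) (hh : (zpowers h).index = 2) (hne : zpowers g ≠ zpowers h) :
    h ∉ zpowers g := fun hc =>
  hne (eq_of_le_of_index_eq_two hh hg (zpowers_le.2 hc)).symm

/-- A noncyclic 2-group of order at least 16 with two cyclic subgroups of index two has commuting
involutions. -/
theorem hasCommutingInvolutions_of_zpowers_ne {G : Type*} [Group G] {l : ℕ}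
    (hcard : Nat.card G = 2 ^ (l + 4)) (hcyc : ¬ IsCyclic G) {g h : G}
    (hg : (zpowers g).index = 2) (hh : (zpowers h).index = 2) (hne : zpowers g ≠ zpowers h) :
    HasCommutingInvolutions G := by
  have : Finite G := Nat.finite_of_card_ne_zero (by rw [hcard]; positivity)
  by_contra hc
  obtain ⟨z, hz1, hz2, hz⟩ := exists_unique_involution (l := l + 3) hcard hc
  obtain ⟨-, h2⟩ := conj_eq_inv_of_unique_involution (n := l + 1) hcard hcyc hz hg
    (notMem_of_zpowers_ne hg hh hne)
  have hog := orderOf_eq_of_index_eq_two (l := l + 3) hcard hg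
  have hoh := orderOf_eq_of_index_eq_two (l := l + 3) hcard hh
  -- Here `h²` is the involution of `⟨g⟩`, whereas `h` has order at least 8.
  have h4 : h ^ 4 = 1 := by
    rw [show 4 = 2 * 2 from rfl, pow_mul, h2, ← pow_mul, ← pow_succ]
    exact orderOf_dvd_iff_pow_eq_one.1 hog.dvd
  have := orderOf_le_of_pow_eq_one (by norm_num) h4
  rw [hoh, pow_add] at this
  have := Nat.one_le_two_pow (n := l)
  omega

/-- A noncyclic 2-group of order at least 16 with two cyclic subgroups of index two is generated by
an element `a` and an involution `b`, with `b` centralising `a` or acting on it as in the modular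
group. -/
theorem exists_modular_generators {G : Type*} [Group G] {l : ℕ}
    (hcard : Nat.card G = 2 ^ (l + 4)) (hcyc : ¬ IsCyclic G) {g h : G}
    (hg : (zpowers g).index = 2) (hh : (zpowers h).index = 2) (hne : zpowers g ≠ zpowers h) :
    ∃ b : G, b ∉ zpowers g ∧ b ^ 2 = 1 ∧
      (b * g * b⁻¹ = g ∨ b * g * b⁻¹ = g ^ (1 + 2 ^ (l + 2))) := by
  have : Finite G := Nat.finite_of_card_ne_zero (by rw [hcard]; positivity)
  obtain ⟨s, t, hs, ht, hst, hs2, ht2, -⟩ :=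
    hasCommutingInvolutions_of_zpowers_ne hcard hcyc hg hh hne
  obtain ⟨b, hb, hb2⟩ : ∃ b, b ∉ zpowers g ∧ b ^ 2 = 1 := by
    by_contra! hc
    exact hst (eq_of_sq_eq_one_of_mem_zpowers (not_imp_not.1 (hc s) hs2)
      (not_imp_not.1 (hc t) ht2) hs ht hs2 ht2)
  refine ⟨b, hb, hb2, ?_⟩
  have hord := orderOf_eq_of_index_eq_two (l := l + 3) hcard hg
  have hone := zpow_eq_one_iff_of_orderOf hord
  have hbh : b * h⁻¹ ∈ zpowers g := by
    have := notMem_of_zpowers_ne hg hh hne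
    rw [mul_mem_iff_of_index_two hg, inv_mem_iff]; tauto
  -- `b` lies in `⟨g⟩h`, and `g²` lies in both `⟨g⟩` and `⟨h⟩`, hence commutes with both factors.
  have hcomm : Commute b (g ^ 2) := by
    obtain ⟨i, hi⟩ := hbh
    obtain ⟨j, hj⟩ := sq_mem_of_index_two hh g
    have e1 : Commute (b * h⁻¹) (g ^ 2) := by
      rw [← hi]; exact (Commute.refl g).zpow_left i |>.pow_right 2
    have e2 : Commute h (g ^ 2) := by
      rw [← hj]; exact (Commute.refl h).zpow_right j
    simpa using e1.mul_left e2
  obtain ⟨u, hu⟩ := conj_mem_zpowers_of_index_eq_two hg b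
  have hu2 : (2 : ℤ) ^ (l + 3) ∣ u * 2 - 2 := by
    rw [← hone, zpow_sub, mul_inv_eq_one, zpow_mul, ← hu, conj_zpow]
    have : b * g ^ 2 * b⁻¹ = g ^ 2 := by rw [hcomm.eq]; group
    exact_mod_cast this
  obtain ⟨c, hc⟩ := hu2
  have hc' : u = 1 + 2 ^ (l + 2) * c := by
    have : (2 : ℤ) ^ (l + 3) = 2 * 2 ^ (l + 2) := by ring
    rw [this] at hc
    linarith
  -- As `g` has order `2 ^ (l + 3)`, only the parity of `c` in `u = 1 + 2 ^ (l + 2) * c` matters.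
  rcases Int.even_or_odd' c with ⟨d, hd | hd⟩
  · left
    rw [hu, ← mul_inv_eq_one, ← zpow_sub_one, hone]
    exact ⟨d, by rw [hc', hd]; ring⟩
  · right
    rw [hu, ← zpow_natCast, ← mul_inv_eq_one, ← zpow_sub, hone]
    exact ⟨d, by rw [hc', hd]; push_cast; ring⟩

/-! ### The groups `C_{2^n} × C_2` and the modular groups -/

theorem zpow_mul_eq_mul_zpow {G : Type*} [Group G] {a b : G} {u : ℤ} (hu : b * a * b⁻¹ = a ^ u)
    (k : ℤ) : b * a ^ k = a ^ (u * k) * b := by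
  rw [zpow_mul, ← hu, conj_zpow]; group

/-- A subgroup is determined by its powers of `a` and one element of the other coset. -/
theorem eq_of_zpow_mem_iff {G : Type*} [Group G] {a b : G}
    (hgen : ∀ x : G, ∃ m : ℤ, x = a ^ m ∨ x = a ^ m * b) {H K : Subgroup G}
    (htr : ∀ m : ℤ, a ^ m ∈ H ↔ a ^ m ∈ K)
    (hb : (∀ m : ℤ, a ^ m * b ∉ H ∧ a ^ m * b ∉ K) ∨ ∃ j : ℤ, a ^ j * b ∈ H ∧ a ^ j * b ∈ K) :
    H = K := by
  have key : ∀ j m : ℤ, a ^ m * b = a ^ (m - j) * (a ^ j * b) := fun j m => by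
    rw [← mul_assoc, ← zpow_add, sub_add_cancel]
  ext x
  obtain ⟨m, rfl | rfl⟩ := hgen x
  · exact htr m
  · rcases hb with hb | ⟨j, hj⟩
    · simp [hb m]
    · rw [key j, mul_mem_cancel_right hj.1, mul_mem_cancel_right hj.2, htr]

/-- The exponents `m` with `a ^ m ∈ H` form a subgroup `dℤ` of `ℤ` containing `2 ^ n`, so `d` is a
power of two up to sign. The exact order of `a` plays no role. -/
theorem exists_zpow_mem_iff {G : Type*} [Group G] {a : G} {n : ℕ} (ha : a ^ 2 ^ n = 1)
    (H : Subgroup G) : ∃ i ≤ n, ∀ m : ℤ, a ^ m ∈ H ↔ (2 : ℤ) ^ i ∣ m := by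
  let S : AddSubgroup ℤ :=
    { carrier := {m | a ^ m ∈ H}
      add_mem' := fun {x y} hx hy => by
        change a ^ (x + y) ∈ H
        rw [zpow_add]; exact H.mul_mem hx hy
      zero_mem' := by change a ^ (0 : ℤ) ∈ H; simp
      neg_mem' := fun {x} hx => by
        change a ^ (-x) ∈ H
        rw [zpow_neg]; exact H.inv_mem hx }
  obtain ⟨d, hd⟩ := Int.subgroup_cyclic S
  have hmem : ∀ m : ℤ, a ^ m ∈ H ↔ d ∣ m := by
    intro m
    change m ∈ S ↔ _
    rw [hd, AddSubgroup.mem_closure_singleton]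
    constructor
    · rintro ⟨k, rfl⟩; exact ⟨k, by simp [mul_comm]⟩
    · rintro ⟨k, rfl⟩; exact ⟨k, by simp [mul_comm]⟩
  have hdn : d ∣ (2 : ℤ) ^ n := by
    rw [← hmem]
    have : a ^ ((2 : ℤ) ^ n) = 1 := by exact_mod_cast ha
    rw [this]; exact H.one_mem
  obtain ⟨i, hi, hdi⟩ := (Nat.dvd_prime_pow Nat.prime_two).1
    (show d.natAbs ∣ 2 ^ n by have := Int.natAbs_dvd_natAbs.2 hdn; simpa [Int.natAbs_pow] using this)
  refine ⟨i, hi, fun m => ?_⟩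
  rw [hmem, ← Int.natAbs_dvd, hdi]
  norm_cast

/-- Subgroups of `C_{2^n} × C_2` and of the modular group are at most `3n + 2` in number. -/
theorem card_subgroup_le_of_modular {G : Type*} [Group G] {n e : ℕ} {a b : G}
    (ha : a ^ 2 ^ (n + 3) = 1) (hb : b ^ 2 = 1) (hab : b * a * b⁻¹ = a ^ (1 + 2 ^ (n + 2) * e))
    (hgen : ∀ x : G, ∃ m : ℤ, x = a ^ m ∨ x = a ^ m * b) :
    Nat.card (Subgroup G) ≤ 3 * n + 11 := by
  -- The first coordinate records the trace of `H` on `⟨a⟩`, the second how `H` meets `⟨a⟩b`: not at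
  -- all, in `b`, or in `a ^ 2 ^ (i - 1) * b`. The code `(0, 2)` is never needed, as `a ∈ H` and `a
  -- ^ j * b ∈ H` give `b ∈ H`; this leaves `3 (n + 4) - 1` codes.
  let R : Subgroup G → Fin (n + 4) × Fin 3 → Prop := fun H c =>
    (∀ m : ℤ, a ^ m ∈ H ↔ (2 : ℤ) ^ (c.1 : ℕ) ∣ m) ∧
    (c.2 = 0 → ∀ m : ℤ, a ^ m * b ∉ H) ∧ (c.2 = 1 → b ∈ H) ∧
    (c.2 = 2 → a ^ ((2 : ℤ) ^ ((c.1 : ℕ) - 1)) * b ∈ H)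
  have hex : ∀ H, ∃ c : {c : Fin (n + 4) × Fin 3 // c ≠ (0, 2)}, R H c := by
    intro H
    obtain ⟨i, hi, hH⟩ := exists_zpow_mem_iff ha H
    by_cases h0 : ∀ m : ℤ, a ^ m * b ∉ H
    · exact ⟨⟨(⟨i, by omega⟩, 0), by simp⟩, hH, fun _ => h0, by simp, by simp⟩
    by_cases h1 : b ∈ H
    · exact ⟨⟨(⟨i, by omega⟩, 1), by simp⟩, hH, by simp, fun _ => h1, by simp⟩
    push Not at h0
    obtain ⟨j, hj⟩ := h0
    have hjn : ¬ (2 : ℤ) ^ i ∣ j := fun hc => h1 ((mul_mem_cancel_left ((hH j).2 hc)).1 hj)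
    have hi0 : i ≠ 0 := by rintro rfl; simp at hjn
    obtain ⟨k, rfl⟩ : ∃ k, i = k + 1 := ⟨i - 1, by omega⟩
    -- The square of `a ^ j * b` is `a` to the power `2j` times an odd number, so `2 ^ (i - 1)`
    -- divides `j`. Since `2 ^ i` does not, `j` may be moved to `2 ^ (i - 1)` by a multiple of `2 ^
    -- i`.
    have hsq := H.pow_mem hj 2
    rw [zpow_mul_mul_sq (u := ((1 + 2 ^ (n + 2) * e : ℕ) : ℤ)) (k := 0)
      (by rw [zpow_natCast]; exact hab) (by simpa using hb), hH] at hsq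
    have hkj : (2 : ℤ) ^ k ∣ j := by
      have hc : IsCoprime ((2 : ℤ) ^ k) (2 * (2 ^ n * e) + 1) :=
        IsCoprime.pow_left ⟨-(2 ^ n * e), 1, by ring⟩
      refine hc.dvd_of_dvd_mul_right ?_
      apply Int.dvd_of_mul_dvd_mul_left (two_ne_zero)
      have e1 : (2 : ℤ) * 2 ^ k = 2 ^ (k + 1) := by ring
      rw [e1]
      convert hsq using 1
      push_cast; ring
    obtain ⟨w, rfl⟩ := hkj
    have hw : ¬ (2 : ℤ) ∣ w := by
      rintro ⟨c, rfl⟩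
      exact hjn ⟨c, by ring⟩
    obtain ⟨c, hc⟩ : (2 : ℤ) ∣ 1 - w := by omega
    refine ⟨⟨(⟨k + 1, by omega⟩, 2), by simp⟩, hH, by simp, by simp, fun _ => ?_⟩
    have hm : a ^ ((2 : ℤ) ^ (k + 1) * c) ∈ H := (hH _).2 (dvd_mul_right _ _)
    have := H.mul_mem hm hj
    rw [← mul_assoc, ← zpow_add] at this
    convert this using 3
    rw [Nat.add_sub_cancel]
    linear_combination 2 ^ k * hc
  choose f hf using hex
  have hinj : Function.Injective f := by
    intro H K hHK
    have h1 := hf H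
    have h2 := hf K
    rw [← hHK] at h2
    generalize f H = c at h1 h2
    obtain ⟨⟨c, t⟩, hct⟩ := c
    refine eq_of_zpow_mem_iff hgen (fun m => (h1.1 m).trans (h2.1 m).symm) ?_
    obtain ⟨-, h10, h11, h12⟩ := h1
    obtain ⟨-, h20, h21, h22⟩ := h2
    fin_cases t
    · exact Or.inl fun m => ⟨h10 rfl m, h20 rfl m⟩
    · exact Or.inr ⟨0, by simpa using h11 rfl, by simpa using h21 rfl⟩
    · exact Or.inr ⟨_, h12 rfl, h22 rfl⟩
  refine (Nat.card_le_card_of_injective f hinj).trans ?_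
  rw [Nat.card_eq_fintype_card]
  simp
  omega

theorem nonempty_mulEquiv_cyclicGrp_prod {G : Type*} [Group G] {l : ℕ}
    (hcard : Nat.card G = 2 ^ (l + 1)) {a b : G} (ha : (zpowers a).index = 2)
    (hb : b ∉ zpowers a) (hb2 : b ^ 2 = 1) (hab : b * a * b⁻¹ = a) :
    Nonempty (G ≃* CyclicGrp (2 ^ l) × CyclicGrp 2) := by
  have : Finite G := Nat.finite_of_card_ne_zero (by rw [hcard]; positivity)
  have hca : Nat.card (zpowers a) = 2 ^ l := card_eq_of_index_eq_two hcard ha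
  have hcb : Nat.card (zpowers b) = 2 := by
    rw [Nat.card_zpowers]
    exact orderOf_eq_prime hb2 fun h => hb (h ▸ one_mem _)
  have hcomm : Commute a b := (mul_inv_eq_iff_eq_mul.1 hab).symm
  let f : zpowers a × zpowers b →* G :=
    (zpowers a).subtype.noncommCoprod (zpowers b).subtype (by
      rintro ⟨_, i, rfl⟩ ⟨_, j, rfl⟩
      exact hcomm.zpow_zpow i j)
  have hf : Function.Surjective f := by
    rw [← MonoidHom.range_eq_top]
    refine eq_top_of_index_eq_two_of_lt ha ?_ (b := b) ⟨(1, ⟨b, mem_zpowers b⟩), by simp [f]⟩ hb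
    rw [zpowers_le]
    exact ⟨(⟨a, mem_zpowers a⟩, 1), by simp [f]⟩
  have hbij := hf.bijective_of_nat_card_le (by rw [Nat.card_prod, hca, hcb, hcard, pow_succ])
  have e1 : zpowers a ≃* CyclicGrp (2 ^ l) := mulEquivOfCyclicCardEq (by
    rw [hca]; exact (Nat.card_zmod _).symm)
  have e2 : zpowers b ≃* CyclicGrp 2 := mulEquivOfCyclicCardEq (by
    rw [hcb]; exact (Nat.card_zmod _).symm)
  exact ⟨(MulEquiv.ofBijective f hbij).symm.trans (e1.prodCongr e2)⟩

theorem exists_eq_zpow_mul_of_closure {G : Type*} [Group G] {a b : G} {u : ℤ}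
    (hcl : closure {a, b} = ⊤) (hb : b ^ 2 = 1) (hab : b * a * b⁻¹ = a ^ u) (x : G) :
    ∃ m : ℤ, x = a ^ m ∨ x = a ^ m * b := by
  have hbb : b * b = 1 := by rw [← sq, hb]
  let S : Subgroup G :=
    { carrier := {x | ∃ m : ℤ, x = a ^ m ∨ x = a ^ m * b}
      mul_mem' := by
        rintro _ _ ⟨x, rfl | rfl⟩ ⟨y, rfl | rfl⟩
        · exact ⟨x + y, .inl (zpow_add a x y).symm⟩
        · exact ⟨x + y, .inr (by rw [zpow_add, mul_assoc])⟩
        · exact ⟨x + u * y, .inr (by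
            rw [mul_assoc, zpow_mul_eq_mul_zpow hab, ← mul_assoc, zpow_add])⟩
        · exact ⟨x + u * y, .inl (by
            rw [mul_assoc, ← mul_assoc b, zpow_mul_eq_mul_zpow hab, mul_assoc _ b b, hbb, mul_one,
              zpow_add])⟩
      one_mem' := ⟨0, by simp⟩
      inv_mem' := by
        rintro _ ⟨x, rfl | rfl⟩
        · exact ⟨-x, .inl (zpow_neg a x).symm⟩
        · exact ⟨u * -x, .inr (by
            rw [← zpow_mul_eq_mul_zpow hab, mul_inv_rev, inv_eq_of_mul_eq_one_left hbb,
              zpow_neg])⟩ }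
  have : closure {a, b} ≤ S := by
    rw [closure_le]
    rintro _ (rfl | rfl)
    · exact ⟨1, by simp⟩
    · exact ⟨0, by simp⟩
  exact this (hcl ▸ mem_top x)

theorem ModularGroup.relations (l : ℕ) :
    (PresentedGroup.of 0 : ModularGroup 2 l) ^ 2 ^ (l - 1) = 1 ∧
    (PresentedGroup.of 1 : ModularGroup 2 l) ^ 2 = 1 ∧
    (PresentedGroup.of 1 : ModularGroup 2 l) * PresentedGroup.of 0 * (PresentedGroup.of 1)⁻¹ =
      PresentedGroup.of 0 ^ (1 + 2 ^ (l - 2)) := by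
  have h1 : (PresentedGroup.of 0 : ModularGroup 2 l) ^ 2 ^ (l - 1) = 1 :=
    PresentedGroup.one_of_mem (rels := modularRels 2 l) (by simp [modularRels])
  have h2 : (PresentedGroup.of 1 : ModularGroup 2 l) ^ 2 = 1 :=
    PresentedGroup.one_of_mem (rels := modularRels 2 l) (by simp [modularRels])
  have h3 : (PresentedGroup.of 1 : ModularGroup 2 l)⁻¹ * PresentedGroup.of 0 * PresentedGroup.of 1 *
      (PresentedGroup.of 0 ^ (1 + 2 ^ (l - 2)))⁻¹ = 1 :=
    PresentedGroup.one_of_mem (rels := modularRels 2 l)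
      (x := (FreeGroup.of 1)⁻¹ * FreeGroup.of 0 * FreeGroup.of 1 *
        (FreeGroup.of 0 ^ (1 + 2 ^ (l - 2)))⁻¹) (by simp [modularRels])
  refine ⟨h1, h2, ?_⟩
  -- The relator conjugates by `b` on the other side, which is the same because `b² = 1`.
  have hi : (PresentedGroup.of 1 : ModularGroup 2 l)⁻¹ = PresentedGroup.of 1 :=
    inv_eq_of_mul_eq_one_left (by rw [← sq, h2])
  rw [mul_inv_eq_one, hi] at h3
  rw [hi, h3]

theorem ModularGroup.exists_eq_zpow_mul (l : ℕ) (x : ModularGroup 2 l) :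
    ∃ m : ℤ, x = PresentedGroup.of 0 ^ m ∨ x = PresentedGroup.of 0 ^ m * PresentedGroup.of 1 := by
  obtain ⟨-, h2, h3⟩ := ModularGroup.relations l
  refine exists_eq_zpow_mul_of_closure (u := ((1 + 2 ^ (l - 2) : ℕ) : ℤ)) ?_ h2
    (by rw [zpow_natCast]; exact h3) x
  rw [← PresentedGroup.closure_range_of (modularRels 2 l)]
  congr 1
  ext y
  simp [Fin.exists_fin_two, eq_comm]

/-- The normal form `a ^ m` or `a ^ m * b` bounds the order from above. No lower bound is needed: a
surjection onto a group of order `2 ^ (l + 1)` is then bijective. -/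
theorem ModularGroup.finite_and_card_le (l : ℕ) :
    Finite (ModularGroup 2 (l + 1)) ∧ Nat.card (ModularGroup 2 (l + 1)) ≤ 2 ^ (l + 1) := by
  obtain ⟨h1, -, -⟩ := ModularGroup.relations (l + 1)
  rw [Nat.add_sub_cancel] at h1
  set a : ModularGroup 2 (l + 1) := PresentedGroup.of 0
  set b : ModularGroup 2 (l + 1) := PresentedGroup.of 1
  have hfin : (zpowers a : Set (ModularGroup 2 (l + 1))).Finite :=
    finite_zpowers.2 (isOfFinOrder_iff_pow_eq_one.2 ⟨_, by positivity, h1⟩)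
  have hcard : (zpowers a : Set (ModularGroup 2 (l + 1))).ncard ≤ 2 ^ l := by
    change Nat.card (zpowers a) ≤ _
    rw [Nat.card_zpowers]
    exact orderOf_le_of_pow_eq_one (by positivity) h1
  have hsub : (Set.univ : Set (ModularGroup 2 (l + 1))) ⊆
      (zpowers a : Set (ModularGroup 2 (l + 1))) ∪ (fun x => x * b) '' (zpowers a) := by
    intro x _
    obtain ⟨m, h | h⟩ := ModularGroup.exists_eq_zpow_mul (l + 1) x
    · exact .inl ⟨m, h.symm⟩
    · exact .inr ⟨a ^ m, ⟨m, rfl⟩, h.symm⟩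
  have hfu := hfin.union (hfin.image fun x => x * b)
  refine ⟨Set.finite_univ_iff.1 (hfu.subset hsub), ?_⟩
  have e1 := Set.ncard_le_ncard hsub hfu
  have e2 := Set.ncard_union_le (zpowers a : Set (ModularGroup 2 (l + 1)))
    ((fun x => x * b) '' (zpowers a))
  have e3 := Set.ncard_image_le (f := fun x => x * b) hfin
  rw [Set.ncard_univ] at e1
  rw [pow_succ]
  omega

theorem nonempty_mulEquiv_modularGroup {G : Type*} [Group G] {l : ℕ}
    (hcard : Nat.card G = 2 ^ (l + 2)) {a b : G} (ha : (zpowers a).index = 2)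
    (hb : b ∉ zpowers a) (hb2 : b ^ 2 = 1) (hab : b * a * b⁻¹ = a ^ (1 + 2 ^ l)) :
    Nonempty (G ≃* ModularGroup 2 (l + 2)) := by
  have hord := orderOf_eq_of_index_eq_two (l := l + 1) hcard ha
  have hbi : b⁻¹ = b := inv_eq_of_mul_eq_one_left (by rw [← sq, hb2])
  have hrel : ∀ r ∈ modularRels 2 (l + 2), FreeGroup.lift ![a, b] r = 1 := by
    rintro r (rfl | rfl | rfl)
    · simp [← hord, pow_orderOf_eq_one]
    · simp [hb2]
    · rw [hbi] at hab
      simp [hbi, hab]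
  let f : ModularGroup 2 (l + 2) →* G := PresentedGroup.toGroup hrel
  have hf : Function.Surjective f := by
    rw [← MonoidHom.range_eq_top]
    refine eq_top_of_index_eq_two_of_lt ha ?_ (b := b)
      ⟨PresentedGroup.of 1, by simp [f, PresentedGroup.toGroup.of]⟩ hb
    rw [zpowers_le]
    exact ⟨PresentedGroup.of 0, by simp [f, PresentedGroup.toGroup.of]⟩
  obtain ⟨_, hle⟩ := ModularGroup.finite_and_card_le (l + 1)
  have hbij := hf.bijective_of_nat_card_le (by rw [hcard]; exact hle)
  exact ⟨(MulEquiv.ofBijective f hbij).symm⟩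

theorem card_subgroup_modularGroup_le (n : ℕ) :
    Nat.card (Subgroup (ModularGroup 2 (n + 4))) ≤ 3 * n + 11 := by
  obtain ⟨h1, h2, h3⟩ := ModularGroup.relations (n + 4)
  exact card_subgroup_le_of_modular (e := 1) h1 h2 (by rw [mul_one]; exact h3)
    (ModularGroup.exists_eq_zpow_mul (n + 4))

theorem card_subgroup_cyclicGrp_prod_le (n : ℕ) :
    Nat.card (Subgroup (CyclicGrp (2 ^ (n + 3)) × CyclicGrp 2)) ≤ 3 * n + 11 := by
  have hpow : ∀ m : ℤ, (Multiplicative.ofAdd (1 : ZMod (2 ^ (n + 3)))) ^ m =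
      Multiplicative.ofAdd (m : ZMod (2 ^ (n + 3))) := fun m => by
    rw [← ofAdd_zsmul]; simp
  refine card_subgroup_le_of_modular (e := 0) (a := (Multiplicative.ofAdd 1, 1))
    (b := (1, Multiplicative.ofAdd 1)) ?_ ?_ ?_ ?_
  · refine Prod.ext ?_ (by simp)
    change (Multiplicative.ofAdd (1 : ZMod (2 ^ (n + 3)))) ^ 2 ^ (n + 3) = 1
    rw [← ofAdd_nsmul]
    simp
  · exact Prod.ext (by simp)
      (show (Multiplicative.ofAdd (1 : ZMod 2)) ^ 2 = 1 by decide)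
  · rw [mul_comm]; simp
  · rintro ⟨x, y⟩
    refine ⟨((Multiplicative.toAdd x).val : ℤ), ?_⟩
    have hx : (Multiplicative.ofAdd (1 : ZMod (2 ^ (n + 3)))) ^ ((Multiplicative.toAdd x).val : ℤ)
        = x := by
      rw [hpow]; simp
    have hy : y = 1 ∨ y = Multiplicative.ofAdd 1 := by revert y; decide
    rcases hy with rfl | rfl
    · left; exact Prod.ext hx.symm (by simp)
    · right; exact Prod.ext (by rw [Prod.fst_mul, Prod.pow_fst, hx, mul_one]) (by simp)

/-! ### Generalised quaternion groups -/

/-- In a group with `b a b⁻¹ = a⁻¹` and `b² = a^(2^m)`, the subgroup generated by `a^(2^i)` and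
`a^j b`. -/
def quaternionSubgroup {G : Type*} [Group G] {m : ℕ} {a b : G} (hab : b * a * b⁻¹ = a⁻¹)
    (hb : b ^ 2 = a ^ 2 ^ m) {i : ℕ} (hi : i ≤ m) (j : ℤ) : Subgroup G where
  carrier := {x | ∃ k : ℤ, x = a ^ ((2 : ℤ) ^ i * k) ∨ x = a ^ ((2 : ℤ) ^ i * k + j) * b}
  mul_mem' := by
    have hab' : b * a * b⁻¹ = a ^ (-1 : ℤ) := by simpa using hab
    -- The condition `i ≤ m` puts `b²` in `⟨a ^ 2 ^ i⟩`; as every element of `⟨a⟩b` squares to `b²`,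
    -- this is what closes the set under multiplication.
    have hbb : b * b = a ^ ((2 : ℤ) ^ i * 2 ^ (m - i)) := by
      rw [← pow_add, Nat.add_sub_cancel' hi, ← sq, hb]; norm_cast
    rintro _ _ ⟨x, rfl | rfl⟩ ⟨y, rfl | rfl⟩
    · exact ⟨x + y, .inl (by rw [← zpow_add, mul_add])⟩
    · exact ⟨x + y, .inr (by rw [← mul_assoc, ← zpow_add, ← add_assoc, mul_add])⟩
    · refine ⟨x - y, .inr ?_⟩
      rw [mul_assoc, zpow_mul_eq_mul_zpow hab', ← mul_assoc, ← zpow_add]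
      congr 2; ring
    · refine ⟨x - y + 2 ^ (m - i), .inl ?_⟩
      rw [mul_assoc, ← mul_assoc b, zpow_mul_eq_mul_zpow hab', mul_assoc _ b b, hbb, ← zpow_add,
        ← zpow_add]
      congr 1; ring
  one_mem' := ⟨0, by simp⟩
  inv_mem' := by
    have hab' : b * a * b⁻¹ = a ^ (-1 : ℤ) := by simpa using hab
    have hbb : b * b = a ^ ((2 : ℤ) ^ i * 2 ^ (m - i)) := by
      rw [← pow_add, Nat.add_sub_cancel' hi, ← sq, hb]; norm_cast
    rintro _ ⟨x, rfl | rfl⟩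
    · exact ⟨-x, .inl (by rw [← zpow_neg]; congr 1; ring)⟩
    · refine ⟨x - 2 ^ (m - i), .inr ?_⟩
      apply inv_eq_of_mul_eq_one_left
      rw [mul_assoc, ← mul_assoc b, zpow_mul_eq_mul_zpow hab', mul_assoc _ b b, hbb, ← zpow_add,
        ← zpow_add, ← zpow_zero a]
      congr 1; ring

theorem mem_quaternionSubgroup {G : Type*} [Group G] {m : ℕ} {a b : G} (hab : b * a * b⁻¹ = a⁻¹)
    (hb : b ^ 2 = a ^ 2 ^ m) {i : ℕ} (hi : i ≤ m) (j : ℤ) (x : G) :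
    x ∈ quaternionSubgroup hab hb hi j ↔
      ∃ k : ℤ, x = a ^ ((2 : ℤ) ^ i * k) ∨ x = a ^ ((2 : ℤ) ^ i * k + j) * b :=
  Iff.rfl

theorem zpow_eq_zpow_iff_of_orderOf {G : Type*} [Group G] {n : ℕ} {a : G} (ha : orderOf a = 2 ^ n)
    (p q : ℤ) : a ^ p = a ^ q ↔ (2 : ℤ) ^ n ∣ p - q := by
  rw [← zpow_eq_one_iff_of_orderOf ha, zpow_sub, mul_inv_eq_one]

theorem zpow_ne_zpow_mul {G : Type*} [Group G] {a b : G} (hb : b ∉ zpowers a) (p q : ℤ) :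
    a ^ p ≠ a ^ q * b := by
  intro h
  apply hb
  rw [← mul_mem_cancel_left (zpow_mem_zpowers a q), ← h]
  exact zpow_mem_zpowers a p

theorem zpow_mem_quaternionSubgroup {G : Type*} [Group G] {m : ℕ} {a b : G}
    (hab : b * a * b⁻¹ = a⁻¹) (hb : b ^ 2 = a ^ 2 ^ m) {i : ℕ} (hi : i ≤ m) (j : ℤ)
    (ha : orderOf a = 2 ^ (m + 1)) (hba : b ∉ zpowers a) (p : ℤ) :
    a ^ p ∈ quaternionSubgroup hab hb hi j ↔ (2 : ℤ) ^ i ∣ p := by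
  rw [mem_quaternionSubgroup]
  constructor
  · rintro ⟨k, h | h⟩
    · rw [zpow_eq_zpow_iff_of_orderOf ha] at h
      exact (dvd_sub_left (dvd_mul_right _ k)).1 ((pow_dvd_pow 2 (by omega)).trans h)
    · exact absurd h (zpow_ne_zpow_mul hba _ _)
  · rintro ⟨k, rfl⟩
    exact ⟨k, .inl rfl⟩

theorem zpow_mul_mem_quaternionSubgroup {G : Type*} [Group G] {m : ℕ} {a b : G}
    (hab : b * a * b⁻¹ = a⁻¹) (hb : b ^ 2 = a ^ 2 ^ m) {i : ℕ} (hi : i ≤ m) (j : ℤ)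
    (ha : orderOf a = 2 ^ (m + 1)) (hba : b ∉ zpowers a) (p : ℤ) :
    a ^ p * b ∈ quaternionSubgroup hab hb hi j ↔ (2 : ℤ) ^ i ∣ p - j := by
  rw [mem_quaternionSubgroup]
  constructor
  · rintro ⟨k, h | h⟩
    · exact absurd h.symm (zpow_ne_zpow_mul hba _ _)
    · rw [mul_left_inj, zpow_eq_zpow_iff_of_orderOf ha] at h
      have := (pow_dvd_pow (2 : ℤ) (show i ≤ m + 1 by omega)).trans h
      rw [show p - ((2 : ℤ) ^ i * k + j) = (p - j) - 2 ^ i * k by ring] at this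
      exact (dvd_sub_left (dvd_mul_right _ k)).1 this
  · rintro ⟨k, hk⟩
    exact ⟨k, .inr (by rw [← hk, sub_add_cancel])⟩

theorem exists_eq_zpow_mul_of_index_eq_two {G : Type*} [Group G] {a b : G}
    (ha : (zpowers a).index = 2) (hb : b ∉ zpowers a) (x : G) :
    ∃ m : ℤ, x = a ^ m ∨ x = a ^ m * b := by
  by_cases hx : x ∈ zpowers a
  · obtain ⟨m, rfl⟩ := hx
    exact ⟨m, .inl rfl⟩
  · obtain ⟨m, hm⟩ : x * b⁻¹ ∈ zpowers a := by
      rw [mul_mem_iff_of_index_two ha, inv_mem_iff]; tauto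
    exact ⟨m, .inr (eq_mul_of_mul_inv_eq hm.symm)⟩

/-- The generalised quaternion group of order `2^(m+2)` has `(m + 1) + 2^(m+1)` subgroups. -/
theorem card_subgroup_of_quaternion {G : Type*} [Group G] {m : ℕ}
    (hcard : Nat.card G = 2 ^ (m + 2)) {a b : G} (ha : (zpowers a).index = 2)
    (hba : b ∉ zpowers a) (hab : b * a * b⁻¹ = a⁻¹) (hb : b ^ 2 = a ^ 2 ^ m) :
    Nat.card (Subgroup G) = (m + 1) + 2 ^ (m + 1) := by
  have hord := orderOf_eq_of_index_eq_two (l := m + 1) hcard ha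
  have hab' : b * a * b⁻¹ = a ^ (-1 : ℤ) := by simpa using hab
  have hgen := exists_eq_zpow_mul_of_index_eq_two ha hba
  -- The `m + 2` subgroups of `⟨a⟩`, and for each `i ≤ m` those generated by `a ^ 2 ^ i` and `a ^ j
  -- * b`, with `j` taken modulo `2 ^ i`.
  let F : Fin (m + 2) ⊕ (Σ i : Fin (m + 1), Fin (2 ^ (i : ℕ))) → Subgroup G :=
    Sum.elim (fun i => zpowers (a ^ ((2 : ℤ) ^ (i : ℕ))))
      (fun c => quaternionSubgroup hab hb (i := c.1) (by omega) (c.2 : ℕ))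
  have mem_cyc : ∀ i ≤ m + 1, ∀ p : ℤ,
      a ^ p ∈ zpowers (a ^ ((2 : ℤ) ^ i)) ↔ (2 : ℤ) ^ i ∣ p := by
    intro i hi p
    rw [mem_zpowers_iff]
    constructor
    · rintro ⟨k, hk⟩
      rw [← zpow_mul, zpow_eq_zpow_iff_of_orderOf hord] at hk
      exact (dvd_sub_right (dvd_mul_right _ k)).1 ((pow_dvd_pow 2 hi).trans hk)
    · rintro ⟨k, rfl⟩
      exact ⟨k, (zpow_mul _ _ _).symm⟩
  have notMem_cyc : ∀ (i : ℕ) (p : ℤ), a ^ p * b ∉ zpowers (a ^ ((2 : ℤ) ^ i)) := by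
    rintro i p ⟨k, hk⟩
    have hk' : a ^ (2 ^ i * k) = a ^ p * b := by rw [zpow_mul]; exact hk
    exact zpow_ne_zpow_mul hba _ _ hk'
  have mem_quat : ∀ (i : Fin (m + 1)) (j p : ℤ),
      a ^ p ∈ quaternionSubgroup hab hb (i := i) (by omega) j ↔ (2 : ℤ) ^ (i : ℕ) ∣ p :=
    fun i j p => zpow_mem_quaternionSubgroup hab hb _ j hord hba p
  have mul_mem_quat : ∀ (i : Fin (m + 1)) (j p : ℤ),
      a ^ p * b ∈ quaternionSubgroup hab hb (i := i) (by omega) j ↔ (2 : ℤ) ^ (i : ℕ) ∣ p - j :=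
    fun i j p => zpow_mul_mem_quaternionSubgroup hab hb _ j hord hba p
  have eq_of_dvd : ∀ i k : ℕ, (∀ p : ℤ, (2 : ℤ) ^ i ∣ p ↔ (2 : ℤ) ^ k ∣ p) → i = k := by
    intro i k h
    have h1 := (h (2 ^ k)).2 dvd_rfl
    have h2 := (h (2 ^ i)).1 dvd_rfl
    have h1' : i ≤ k := (Nat.pow_dvd_pow_iff_le_right (by norm_num : 1 < 2)).1 (by exact_mod_cast h1)
    have h2' : k ≤ i := (Nat.pow_dvd_pow_iff_le_right (by norm_num : 1 < 2)).1 (by exact_mod_cast h2)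
    omega
  have hbij : Function.Bijective F := by
    constructor
    · rintro (i | ⟨i, j⟩) (i' | ⟨i', j'⟩) h
      · have : (i : ℕ) = i' := eq_of_dvd _ _ fun p => by
          rw [← mem_cyc i (by omega), ← mem_cyc i' (by omega)]
          exact iff_of_eq (congrArg (a ^ p ∈ ·) h)
        rw [Fin.ext this]
      · have h1 := (mul_mem_quat i' (j' : ℕ) (j' : ℕ)).2 (by simp)
        exact absurd ((congrArg (a ^ ((j' : ℕ) : ℤ) * b ∈ ·) h).mpr h1) (notMem_cyc _ _)
      · have h1 := (mul_mem_quat i (j : ℕ) (j : ℕ)).2 (by simp)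
        exact absurd ((congrArg (a ^ ((j : ℕ) : ℤ) * b ∈ ·) h).mp h1) (notMem_cyc _ _)
      · have hi : (i : ℕ) = i' := eq_of_dvd _ _ fun p => by
          rw [← mem_quat i (j : ℕ), ← mem_quat i' (j' : ℕ)]
          exact iff_of_eq (congrArg (a ^ p ∈ ·) h)
        obtain rfl := Fin.ext hi
        have h1 := (mul_mem_quat i (j : ℕ) (j : ℕ)).2 (by simp)
        have h2 := (mul_mem_quat i (j' : ℕ) (j : ℕ)).1
          ((congrArg (a ^ ((j : ℕ) : ℤ) * b ∈ ·) h).mp h1)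
        have h3 : (j : ℕ) = j' := by
          have hmod := (Nat.modEq_iff_dvd (n := 2 ^ (i : ℕ)) (a := j') (b := j)).2
            (by exact_mod_cast h2)
          exact (hmod.eq_of_lt_of_lt j'.2 j.2).symm
        rw [Fin.ext h3]
    · intro H
      obtain ⟨i, hi, hH⟩ := exists_zpow_mem_iff
        (show a ^ 2 ^ (m + 1) = 1 by rw [← hord, pow_orderOf_eq_one]) H
      by_cases h0 : ∀ p : ℤ, a ^ p * b ∉ H
      · exact ⟨.inl ⟨i, by omega⟩, eq_of_zpow_mem_iff hgen
          (fun p => (mem_cyc i hi p).trans (hH p).symm) (.inl fun p => ⟨notMem_cyc _ _, h0 p⟩)⟩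
      · push Not at h0
        obtain ⟨p, hp⟩ := h0
        -- `(a ^ p * b)² = a ^ 2 ^ m` lies in `H`, so `H` meets `⟨a⟩` at least in the involution.
        have him : i ≤ m := by
          have hsq := H.pow_mem hp 2
          rw [zpow_mul_mul_sq (u := -1) (k := ((2 ^ m : ℕ) : ℤ)) hab'
            (by rw [zpow_natCast]; exact hb), hH] at hsq
          have : (2 : ℤ) ^ i ∣ 2 ^ m := by simpa using hsq
          exact (Nat.pow_dvd_pow_iff_le_right (by norm_num : 1 < 2)).1 (by exact_mod_cast this)
        have hpos : (0 : ℤ) < 2 ^ i := by positivity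
        have hnn := Int.emod_nonneg p hpos.ne'
        have hlt := Int.emod_lt_of_pos p hpos
        obtain ⟨j, hj⟩ := Int.eq_ofNat_of_zero_le hnn
        have hj2 : j < 2 ^ i := by rw [hj] at hlt; exact_mod_cast hlt
        refine ⟨.inr ⟨⟨i, by omega⟩, ⟨j, hj2⟩⟩, eq_of_zpow_mem_iff hgen
          (fun q => (mem_quat ⟨i, by omega⟩ (j : ℕ) q).trans (hH q).symm) (.inr ⟨p, ?_, hp⟩)⟩
        refine (mul_mem_quat ⟨i, by omega⟩ (j : ℕ) p).2 ?_
        rw [← hj]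
        exact Int.dvd_self_sub_emod
  rw [← Nat.card_eq_of_bijective F hbij, Nat.card_eq_fintype_card, Fintype.card_sum,
    Fintype.card_sigma]
  simp only [Fintype.card_fin]
  rw [Fin.sum_univ_eq_sum_range (fun i => 2 ^ i), Nat.geomSum_eq le_rfl]
  have := Nat.one_le_two_pow (n := m + 1)
  simp only [Nat.add_one_sub_one, Nat.div_one]
  omega

/-- The homomorphism from `ZMod k` determined by an element of order dividing `k`. -/
theorem exists_zmod_pow {G : Type*} [Group G] {a : G} {k : ℕ} (ha : a ^ k = 1) :
    ∃ φ : ZMod k → G, (∀ i : ℤ, φ i = a ^ i) := by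
  refine ⟨fun i => a ^ (i.cast : ℤ), fun i => ?_⟩
  have h1 : ((((i : ZMod k).cast : ℤ)) : ZMod k) = i := by simp
  rw [ZMod.intCast_eq_intCast_iff_dvd_sub] at h1
  obtain ⟨c, hc⟩ := h1
  rw [show i = ((i : ZMod k).cast : ℤ) + k * c by linear_combination hc, zpow_add, zpow_mul,
    zpow_natCast, ha]
  simp

theorem nonempty_mulEquiv_quaternionGroup {G : Type*} [Group G] {m : ℕ}
    (hcard : Nat.card G = 2 ^ (m + 2)) {a b : G} (ha : (zpowers a).index = 2)
    (hba : b ∉ zpowers a) (hab : b * a * b⁻¹ = a⁻¹) (hb : b ^ 2 = a ^ 2 ^ m) :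
    Nonempty (G ≃* QuaternionGroup (2 ^ m)) := by
  have hord := orderOf_eq_of_index_eq_two (l := m + 1) hcard ha
  have hab' : b * a * b⁻¹ = a ^ (-1 : ℤ) := by simpa using hab
  obtain ⟨φ, hφ⟩ := exists_zmod_pow (a := a) (k := 2 * 2 ^ m)
    (by rw [← pow_succ', ← hord, pow_orderOf_eq_one])
  -- `xa i` in `QuaternionGroup` corresponds to `b * a ^ i`, so `b` has to be moved to the left.
  have hbz : ∀ k : ℤ, a ^ k * b = b * a ^ (-k) := fun k => by
    rw [zpow_mul_eq_mul_zpow hab']; simp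
  let f : QuaternionGroup (2 ^ m) →* G := MonoidHom.mk'
    (fun x => match x with
      | .a i => φ i
      | .xa i => b * φ i) (by
    rintro (x | x) (y | y) <;> obtain ⟨x, rfl⟩ := ZMod.intCast_surjective x <;>
      obtain ⟨y, rfl⟩ := ZMod.intCast_surjective y
    · simp only [QuaternionGroup.a_mul_a]
      rw [← Int.cast_add, hφ, hφ, hφ, zpow_add]
    · simp only [QuaternionGroup.a_mul_xa]
      rw [← Int.cast_sub, hφ, hφ, hφ, ← mul_assoc, hbz, mul_assoc, ← zpow_add]
      congr 2; ring
    · simp only [QuaternionGroup.xa_mul_a]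
      rw [← Int.cast_add, hφ, hφ, hφ, zpow_add, mul_assoc]
    · simp only [QuaternionGroup.xa_mul_xa]
      rw [← Int.cast_natCast, ← Int.cast_add, ← Int.cast_sub, hφ, hφ, hφ, mul_assoc,
        ← mul_assoc (a ^ x), hbz, mul_assoc b, ← mul_assoc b, ← sq, hb, ← zpow_natCast, ← zpow_add,
        ← zpow_add]
      congr 1; ring)
  have hf : Function.Surjective f := by
    rw [← MonoidHom.range_eq_top]
    refine eq_top_of_index_eq_two_of_lt ha ?_ (b := b) ⟨.xa 0, ?_⟩ hba
    · rw [zpowers_le]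
      refine ⟨.a 1, ?_⟩
      change φ 1 = a
      simpa using hφ 1
    · change b * φ 0 = b
      simpa using hφ 0
  have hbij := hf.bijective_of_nat_card_le (by
    rw [hcard, Nat.card_eq_fintype_card, QuaternionGroup.card, pow_add]
    omega)
  exact ⟨(MulEquiv.ofBijective f hbij).symm⟩

theorem card_subgroup_quaternionGroup (m : ℕ) :
    Nat.card (Subgroup (QuaternionGroup (2 ^ m))) = (m + 1) + 2 ^ (m + 1) := by
  have hcard : Nat.card (QuaternionGroup (2 ^ m)) = 2 ^ (m + 2) := by
    rw [Nat.card_eq_fintype_card, QuaternionGroup.card, pow_add]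
    omega
  refine card_subgroup_of_quaternion hcard (a := .a 1) (b := .xa 0) ?_ ?_ ?_ ?_
  · apply index_eq_two_of_card (l := m + 1) hcard
    rw [Nat.card_zpowers, QuaternionGroup.orderOf_a_one, pow_succ']
  · rw [← mem_powers_iff_mem_zpowers]
    rintro ⟨k, hk⟩
    change QuaternionGroup.a 1 ^ k = _ at hk
    rw [QuaternionGroup.a_one_pow] at hk
    cases hk
  · rw [mul_inv_eq_iff_eq_mul]
    change _ = QuaternionGroup.a (-1) * _
    simp
  · rw [QuaternionGroup.xa_sq, QuaternionGroup.a_one_pow]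

/-! ### The lower bounds and the cases of equality -/

theorem card_subgroup_congr {G H : Type*} [Group G] [Group H] (e : G ≃* H) :
    Nat.card (Subgroup G) = Nat.card (Subgroup H) :=
  Nat.card_congr e.mapSubgroup.toEquiv

/-- A noncyclic 2-group of order at least 16 has a noncyclic subgroup of index two, unless it has
two commuting involutions. -/
theorem exists_not_isCyclic_index_eq_two {G : Type*} [Group G] {l : ℕ}
    (hcard : Nat.card G = 2 ^ (l + 4)) (hcyc : ¬ IsCyclic G) (h : ¬ HasCommutingInvolutions G) :
    ∃ M : Subgroup G, M.index = 2 ∧ ¬ IsCyclic M := by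
  by_contra! hall
  obtain ⟨M, hM, -⟩ := exists_index_eq_two_ge hcard (zpowers_ne_top hcyc 1)
  obtain ⟨M₂, -, h₂, -, hn₂, -⟩ := exists_three_index_eq_two hcard hcyc hM
  obtain ⟨g, rfl⟩ := (Subgroup.isCyclic_iff_exists_zpowers_eq_top M).1 (hall M hM)
  obtain ⟨k, rfl⟩ := (Subgroup.isCyclic_iff_exists_zpowers_eq_top M₂).1 (hall M₂ h₂)
  exact h (hasCommutingInvolutions_of_zpowers_ne hcard hcyc hM h₂ fun hc => hn₂ hc.ge)

/-- A noncyclic group of order `2^λ ≥ 16` has at least `3λ - 1` subgroups. -/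
theorem le_card_subgroup {l : ℕ} : ∀ {G : Type*} [Group G], Nat.card G = 2 ^ (l + 4) →
    ¬ IsCyclic G → 3 * l + 11 ≤ Nat.card (Subgroup G) := by
  induction l with
  | zero =>
    intro G _ hcard hcyc
    by_cases h : HasCommutingInvolutions G
    · exact (h.le_card_subgroup (l := 2) hcard).1
    · obtain ⟨z, hz1, hz2, hz⟩ := exists_unique_involution (l := 3) hcard h
      obtain ⟨a, b, ha, hba, hab, hb⟩ :=
        exists_quaternion_generators (n := 1) le_rfl hcard hcyc hz1 hz2 hz
      exact (card_subgroup_of_quaternion (m := 2) hcard ha hba hab hb).ge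
  | succ l ih =>
    intro G _ hcard hcyc
    have : Finite G := Nat.finite_of_card_ne_zero (by rw [hcard]; positivity)
    by_cases h : HasCommutingInvolutions G
    · exact (h.le_card_subgroup (l := l + 3) hcard).1
    · obtain ⟨M, hM, hMc⟩ := exists_not_isCyclic_index_eq_two (l := l + 1) hcard hcyc h
      have := ih (card_eq_of_index_eq_two (l := l + 4) hcard hM) hMc
      have := (card_subgroup_add_three_le hcard hcyc hM).1
      omega

theorem nonempty_mulEquiv_of_zpowers_ne {G : Type*} [Group G] {l : ℕ}
    (hcard : Nat.card G = 2 ^ (l + 4)) (hcyc : ¬ IsCyclic G) {g h : G}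
    (hg : (zpowers g).index = 2) (hh : (zpowers h).index = 2) (hne : zpowers g ≠ zpowers h) :
    Nonempty (G ≃* CyclicGrp (2 ^ (l + 3)) × CyclicGrp 2) ∨
      Nonempty (G ≃* ModularGroup 2 (l + 4)) := by
  obtain ⟨b, hb, hb2, hbg | hbg⟩ := exists_modular_generators hcard hcyc hg hh hne
  · exact .inl (nonempty_mulEquiv_cyclicGrp_prod hcard hg hb hb2 hbg)
  · exact .inr (nonempty_mulEquiv_modularGroup (l := l + 2) hcard hg hb hb2 hbg)

theorem card_subgroup_le_of_nonempty_mulEquiv {G : Type*} [Group G] {l : ℕ}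
    (h : Nonempty (G ≃* CyclicGrp (2 ^ (l + 3)) × CyclicGrp 2) ∨
      Nonempty (G ≃* ModularGroup 2 (l + 4))) : Nat.card (Subgroup G) ≤ 3 * l + 11 := by
  rcases h with ⟨⟨e⟩⟩ | ⟨⟨e⟩⟩
  · exact card_subgroup_congr e ▸ card_subgroup_cyclicGrp_prod_le l
  · exact card_subgroup_congr e ▸ card_subgroup_modularGroup_le l

/-- From order 32 on, a noncyclic `M` of index two already satisfies the bound `3λ - 1`, so equality
for `G` makes the step from `M` to `G` add exactly 3. This fails in order 16, since `Q_8` has only 6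
subgroups; hence the exception `Q_16` there. -/
theorem card_subgroup_eq_iff {G : Type*} [Group G] {l : ℕ} (hcard : Nat.card G = 2 ^ (l + 5))
    (hcyc : ¬ IsCyclic G) : Nat.card (Subgroup G) = 3 * l + 14 ↔
      Nonempty (G ≃* CyclicGrp (2 ^ (l + 4)) × CyclicGrp 2) ∨
      Nonempty (G ≃* ModularGroup 2 (l + 5)) := by
  constructor
  · intro heq
    by_cases h : HasCommutingInvolutions G
    · obtain ⟨g, k, hg, hk, hne⟩ := (h.le_card_subgroup (l := l + 3) hcard).2 heq
      exact nonempty_mulEquiv_of_zpowers_ne (l := l + 1) hcard hcyc hg hk hne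
    · obtain ⟨M, hM, hMc⟩ := exists_not_isCyclic_index_eq_two (l := l + 1) hcard hcyc h
      have hle := le_card_subgroup (card_eq_of_index_eq_two (l := l + 4) hcard hM) hMc
      have h3 := card_subgroup_add_three_le hcard hcyc hM
      obtain ⟨g, k, hg, hk, hne⟩ := h3.2 (by omega)
      exact nonempty_mulEquiv_of_zpowers_ne (l := l + 1) hcard hcyc hg hk hne
  · intro h
    exact le_antisymm (card_subgroup_le_of_nonempty_mulEquiv (l := l + 1) h)
      (le_card_subgroup (l := l + 1) hcard hcyc)

/-- A noncyclic group of order eight has at least six subgroups, with equality only for `Q_8`. -/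
theorem card_subgroup_of_card_eight {G : Type*} [Group G] (hcard : Nat.card G = 2 ^ 3)
    (hcyc : ¬ IsCyclic G) : 6 ≤ Nat.card (Subgroup G) ∧
      (Nat.card (Subgroup G) = 6 ↔ Nonempty (G ≃* QuaternionGroup 2)) := by
  have hQ : Nonempty (G ≃* QuaternionGroup 2) → Nat.card (Subgroup G) = 6 := by
    rintro ⟨e⟩
    rw [card_subgroup_congr e]
    exact card_subgroup_quaternionGroup 1
  by_cases h : HasCommutingInvolutions G
  · have := (h.le_card_subgroup (l := 1) hcard).1
    exact ⟨by omega, fun _ => by omega, hQ⟩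
  · obtain ⟨z, hz1, hz2, hz⟩ := exists_unique_involution (l := 2) hcard h
    obtain ⟨a, b, ha, hba, hab, hb⟩ :=
      exists_quaternion_generators (n := 0) (by omega) hcard hcyc hz1 hz2 hz
    have e := nonempty_mulEquiv_quaternionGroup (m := 1) hcard ha hba hab hb
    exact ⟨(hQ e).ge, fun _ => e, hQ⟩

/-- The noncyclic groups of order sixteen with exactly eleven subgroups. -/
theorem card_subgroup_eq_eleven_iff {G : Type*} [Group G] (hcard : Nat.card G = 2 ^ 4)
    (hcyc : ¬ IsCyclic G) : Nat.card (Subgroup G) = 11 ↔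
      Nonempty (G ≃* QuaternionGroup 4) ∨ Nonempty (G ≃* ModularGroup 2 4) ∨
      Nonempty (G ≃* CyclicGrp 8 × CyclicGrp 2) := by
  have hle : 11 ≤ Nat.card (Subgroup G) := le_card_subgroup (l := 0) hcard hcyc
  constructor
  · intro heq
    by_cases h : HasCommutingInvolutions G
    · obtain ⟨g, k, hg, hk, hne⟩ := (h.le_card_subgroup (l := 2) hcard).2 heq
      exact .inr (nonempty_mulEquiv_of_zpowers_ne (l := 0) hcard hcyc hg hk hne).symm
    · obtain ⟨z, hz1, hz2, hz⟩ := exists_unique_involution (l := 3) hcard h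
      obtain ⟨a, b, ha, hba, hab, hb⟩ :=
        exists_quaternion_generators (n := 1) le_rfl hcard hcyc hz1 hz2 hz
      exact .inl (nonempty_mulEquiv_quaternionGroup (m := 2) hcard ha hba hab hb)
  · rintro (⟨⟨e⟩⟩ | h)
    · rw [card_subgroup_congr e]
      exact card_subgroup_quaternionGroup 2
    · exact le_antisymm (card_subgroup_le_of_nonempty_mulEquiv (l := 0) h.symm) hle

/-- `QuaternionGroup n` has order `4n`, so `Q_8` and `Q_16` are its values at 2 and 4. The
natural-number subtractions are never truncated, as `5 ≤ l` wherever they occur with a variable `l`.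
-/
theorem theoremB {G : Type*} [Group G] (l : ℕ) (hcard : Nat.card G = 2 ^ l)
    (hcyc : ¬ IsCyclic G) :
    (5 ≤ l →
      3 * l - 1 ≤ Nat.card (Subgroup G) ∧
      (Nat.card (Subgroup G) = 3 * l - 1 ↔
        Nonempty (G ≃* CyclicGrp (2 ^ (l - 1)) × CyclicGrp 2) ∨
        Nonempty (G ≃* ModularGroup 2 l))) ∧
    (l = 3 →
      6 ≤ Nat.card (Subgroup G) ∧
      (Nat.card (Subgroup G) = 6 ↔ Nonempty (G ≃* QuaternionGroup 2))) ∧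
    (l = 4 →
      11 ≤ Nat.card (Subgroup G) ∧
      (Nat.card (Subgroup G) = 11 ↔
        Nonempty (G ≃* QuaternionGroup 4) ∨
        Nonempty (G ≃* ModularGroup 2 4) ∨
        Nonempty (G ≃* CyclicGrp 8 × CyclicGrp 2))) := by 
  refine ⟨fun hl => ?_, ?_, ?_⟩
  · obtain ⟨m, rfl⟩ : ∃ m, l = m + 5 := ⟨l - 5, by omega⟩
    rw [show 3 * (m + 5) - 1 = 3 * m + 14 by omega]
    exact ⟨le_card_subgroup (l := m + 1) hcard hcyc, card_subgroup_eq_iff hcard hcyc⟩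
  · rintro rfl
    exact card_subgroup_of_card_eight hcard hcyc
  · rintro rfl
    exact ⟨le_card_subgroup (l := 0) hcard hcyc, card_subgroup_eq_eleven_iff hcard hcyc⟩
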